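/- A cycle set is a set $S$ with a binary operation $*$ such that every $\psi(s)\colon t\mapsto s*t$ is bijective and $(s*t)*(s*u)=(t*s)*(t*u)$ for all $s,t,u\in S$. Let $S$ be finite, $G=\langle S\mid s(s*t)=t(t*s)\rangle$ its structure group, $T(s)=s*s$, $s^{[k]}=s\,T(s)\cdots T^{k-1}(s)\in G$, and extend $\psi$ to $G$ by $\psi(gh)=\psi(h)\circ\psi(g)$. Write $G^{[k]}=\langle s^{[k]}: s\in S\rangle$, and let $S^{[k]}$ be the cycle set on $S$ with operation $(s,t)\mapsto\psi(s^{[k]})(t)$. The Dehornoy class of $S$ is the least $d>0$ with $\psi(s^{[d]})=\mathrm{id}$ for all $s$. For $m\ge1$ let $\zeta_m=e^{2i\pi/m}$, and let $\overline G_m\subset GL_S(\mathbb C)$ be the image of $G$ under $s\mapsto D_sP_{\psi(s)}$, where $D_s$ is diagonal with entry $\zeta_m$ at $s$ and $1$ elsewhere, and row $i$ of $P_\sigma$ has its $1$ in column $\sigma(i)$. The germ of $S$ is $\overline G=\overline G_d$, and $\overline G^{[k]}$ denotes the image of $G^{[k]}$ in $\overline G$. Let $S_1,S_2$ be cycle sets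 on the same finite set $S$, with coprime classes $d_1,d_2$ and germs $\overline G_1,\overline G_2$ such that $\overline G_1\overline G_2=\overline G_2\overline G_1$ and $\overline G_1\cap\overline G_2=1$. A cycle set on $S$ of class dividing $d_1d_2$ is called the Zappa–Szép product $S_1\bowtie S_2$ if its image group $\overline G_{d_1d_2}$ equals $\overline G_1\overline G_2$. Products of several cycle sets are iterated, $S_1\bowtie(S_2\bowtie(\cdots\bowtie S_r))$, the empty product being the trivial cycle set $s*t=t$. **Theorem.** Every finite cycle set is a Zappa–Szép product of cycle sets whose class is a prime power. More precisely, let $S$ be a finite cycle set. Its class $d$ exists, and the kernel of $G\to\overline G$ is $G^{[d]}$, so that $\overline G\cong G/G^{[d]}$. Let $d=p_1^{a_1}\cdots p_r^{a_r}$ be the prime factorization, with the primes in any order, and $\beta_i=d/p_i^{a_i}$. Then: 1. For each $i$, $\overline G^{[\beta_i]}$ is a Sylow $p_i$-subgroup of $\overline G$; the cycle set $S^{[\beta_i]}$ has class $p_i^{a_i}$, and its germ is $\overline G^{[\beta_i]}$. 2. $\overline G^{[\beta_i]}\overline G^{[\beta_j]}=\overline G^{[\beta_j]}\overline G^{[\beta_i]}$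 for all $i,j$, and every $g\in\overline G$ can be written uniquely as $g=h_1\cdots h_r$ with $h_i\in\overline G^{[\beta_i]}$. 3. $S$ is the Zappa–Szép product $S^{[\beta_1]}\bowtie\cdots\bowtie S^{[\beta_r]}$, and it is the only cycle set on the underlying set that is a Zappa–Szép product of this sequence. 4. $S$ is reconstructed explicitly: let $u_1,\dots,u_r\in\mathbb N$ with $\sum_i\beta_iu_i\equiv1\pmod d$. For $s\in S$ put $t_1=s$, $\sigma_i=\psi_i(t_i^{[u_i]})$, computed in $S^{[\beta_i]}$, and $t_{i+1}=\sigma_i(t_i)$. Then $\psi(s)=\sigma_r\circ\cdots\circ\sigma_1$. -/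

import Mathlib

open scoped Pointwise MatrixGroups

/-- A cycle set structure on `S`: a binary operation all of whose left translations are bijective and
which satisfies `(s * t) * (s * u) = (t * s) * (t * u)`. -/
@[ext]
structure CycleSet (S : Type*) where
  op : S → S → S
  bijective_op : ∀ s, Function.Bijective (op s)
  op_op_op : ∀ s t u, op (op s t) (op s u) = op (op t s) (op t u)

namespace CycleSet

noncomputable section

variable {S : Type*}

/-- The permutation `ψ(s) : t ↦ s * t`. -/
def perm (C : CycleSet S) (s : S) : Equiv.Perm S :=
  Equiv.ofBijective (C.op s) (C.bijective_op s)

/-- The diagonal map `T : s ↦ s * s`. -/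
def diag (C : CycleSet S) (s : S) : S := C.op s s

/-- The trivial cycle set, `s * t = t`. -/
def trivial (S : Type*) : CycleSet S where
  op _ t := t
  bijective_op _ := Function.bijective_id
  op_op_op _ _ _ := rfl

/-- The defining relations `s (s * t) = t (t * s)`, `s ≠ t`, of the structure group. -/
def rels (C : CycleSet S) : Set (FreeGroup S) :=
  {r | ∃ s t : S, s ≠ t ∧
    r = FreeGroup.of s * FreeGroup.of (C.op s t) *
      (FreeGroup.of t * FreeGroup.of (C.op t s))⁻¹}

/-- The structure group `G = ⟨S ∣ s (s * t) = t (t * s)⟩`. -/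
abbrev StructureGroup (C : CycleSet S) : Type _ := PresentedGroup C.rels

/-- The generator of the structure group attached to `s`. -/
def gen (C : CycleSet S) (s : S) : C.StructureGroup := PresentedGroup.of s

theorem gen_mul_gen (C : CycleSet S) (s t : S) :
    C.gen s * C.gen (C.op s t) = C.gen t * C.gen (C.op t s) := by
  by_cases h : s = t
  · rw [h]
  · have h1 := PresentedGroup.one_of_mem (rels := C.rels) ⟨s, t, h, rfl⟩
    rw [map_mul, map_inv, mul_inv_eq_one] at h1
    simpa [gen, PresentedGroup.of] using h1

theorem perm_mul_perm (C : CycleSet S) (s t : S) :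
    C.perm (C.op s t) * C.perm s = C.perm (C.op t s) * C.perm t := by
  ext u
  exact C.op_op_op s t u

/-- `ψ` on the structure group. It reverses products, `ψ(gh) = ψ(h) ∘ ψ(g)`, so it is a morphism to
the opposite of the symmetric group. -/
def psiHom (C : CycleSet S) : C.StructureGroup →* (Equiv.Perm S)ᵐᵒᵖ :=
  PresentedGroup.toGroup (f := fun s => MulOpposite.op (C.perm s)) (by
    rintro r ⟨s, t, -, rfl⟩
    simp only [map_mul, map_inv, FreeGroup.lift_apply_of, mul_inv_eq_one]
    rw [← MulOpposite.op_mul, ← MulOpposite.op_mul, C.perm_mul_perm])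

/-- The permutation `ψ(g)` of an element of the structure group. -/
def psi (C : CycleSet S) (g : C.StructureGroup) : Equiv.Perm S := (C.psiHom g).unop

@[simp]
theorem psi_one (C : CycleSet S) : C.psi 1 = 1 := by simp [psi]

@[simp]
theorem psi_mul (C : CycleSet S) (g h : C.StructureGroup) :
    C.psi (g * h) = C.psi h * C.psi g := by simp [psi]

@[simp]
theorem psi_gen_apply (C : CycleSet S) (s t : S) : C.psi (C.gen s) t = C.op s t := by
  simp [psi, psiHom, gen, perm]

/-- `s^[k] = s T(s) ⋯ T^(k-1)(s)`, an element of the structure group. -/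
def bpow (C : CycleSet S) : ℕ → S → C.StructureGroup
  | 0, _ => 1
  | k + 1, s => C.gen s * C.bpow k (C.diag s)

theorem gen_mul_bpow (C : CycleSet S) (k : ℕ) (s t : S) :
    C.gen s * C.bpow k (C.op s t) = C.bpow k t * C.gen (C.psi (C.bpow k t) s) := by
  induction k generalizing s t with
  | zero => simp [bpow]
  | succ k ih =>
    have h : C.diag (C.op s t) = C.op (C.op t s) (C.diag t) := C.op_op_op s t t
    rw [bpow, bpow, ← mul_assoc, C.gen_mul_gen, mul_assoc, h, ih]
    simp [mul_assoc]

theorem bpow_mul_bpow (C : CycleSet S) (j k : ℕ) (s t : S) :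
    C.bpow j s * C.bpow k (C.psi (C.bpow j s) t) =
      C.bpow k t * C.bpow j (C.psi (C.bpow k t) s) := by
  induction j generalizing s t with
  | zero => simp [bpow]
  | succ j ih =>
    have h1 := C.gen_mul_bpow k s t
    have h2 : C.psi (C.bpow k (C.op s t)) (C.diag s) = C.diag (C.psi (C.bpow k t) s) := by
      have := congrArg (fun g => C.psi g s) h1
      simpa [diag] using this
    have h3 := ih (C.diag s) (C.op s t)
    rw [bpow, bpow, psi_mul, Equiv.Perm.mul_apply, psi_gen_apply, mul_assoc, h3, ← mul_assoc, h1,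
      h2, mul_assoc]

/-- The cycle set `S^[k]`, with `s^[k] ⋆ t^[k] = (ψ(s^[k])(t))^[k]`, carried over to `S` along
`s ↦ s^[k]`. -/
def power (C : CycleSet S) (k : ℕ) : CycleSet S where
  op s t := C.psi (C.bpow k s) t
  bijective_op s := (C.psi (C.bpow k s)).bijective
  op_op_op s t u := by
    have := congrArg (fun g => C.psi g u) (C.bpow_mul_bpow k k s t)
    simpa using this

/-- The Dehornoy class: the least `d > 0` such that every `s^[d]` has trivial permutation part. -/
def dehornoyClass (C : CycleSet S) : ℕ :=
  sInf {d : ℕ | 0 < d ∧ ∀ s, C.psi (C.bpow d s) = 1}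

/-- The permutation that reconstructs `ψ(s)` from factors `A₁, …, A_r` and Bézout coefficients
`u₁, …, u_r`: put `t₁ = s`, `σᵢ = ψᵢ(tᵢ^[uᵢ])` (computed in `Aᵢ`), `tᵢ₊₁ = σᵢ(tᵢ)`; the result is
`σ_r ∘ ⋯ ∘ σ₁`. -/
def bezoutPerm : List (CycleSet S × ℕ) → S → Equiv.Perm S
  | [], _ => 1
  | (A, u) :: L, s =>
      bezoutPerm L (A.psi (A.bpow u s) s) * A.psi (A.bpow u s)

/-- `G^[k]`: the subgroup of the structure group generated by the `s^[k]`. -/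
def powSubgroup (C : CycleSet S) (k : ℕ) : Subgroup C.StructureGroup :=
  Subgroup.closure (Set.range (C.bpow k))

/-- `ζ_m = exp(2πi/m)`. -/
def zeta (m : ℕ) : ℂˣ :=
  Units.mk0 (Complex.exp (2 * Real.pi * Complex.I / m)) (Complex.exp_ne_zero _)

variable [Fintype S] [DecidableEq S]

/-- The monomial matrix `D P_σ`, where `D` is diagonal with entries `c` and row `i` of `P_σ` has its
`1` in column `σ i`. -/
def monomialGL (c : S → ℂˣ) (σ : Equiv.Perm S) : GL S ℂ where
  val := Matrix.diagonal (fun i => (c i : ℂ)) * σ.permMatrix ℂ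
  inv := (σ⁻¹).permMatrix ℂ * Matrix.diagonal (fun i => ((c i)⁻¹ : ℂˣ).val)
  val_inv := by
    rw [mul_assoc, ← mul_assoc (σ.permMatrix ℂ), ← Matrix.permMatrix_mul]
    simp [Matrix.diagonal_mul_diagonal]
  inv_val := by
    rw [mul_assoc, ← mul_assoc (Matrix.diagonal _) (Matrix.diagonal _),
      Matrix.diagonal_mul_diagonal]
    simp [← Matrix.permMatrix_mul]

theorem monomialGL_mul (c c' : S → ℂˣ) (σ τ : Equiv.Perm S) :
    monomialGL c σ * monomialGL c' τ = monomialGL (fun i => c i * c' (σ i)) (τ * σ) := by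
  ext i j
  simp [monomialGL, Matrix.diagonal_mul, Equiv.Perm.permMatrix,
    PEquiv.toMatrix_toPEquiv_mul, PEquiv.toMatrix_apply, mul_assoc]

/-- The monomial representation of the structure group specialized at `q = ζ_m`: the generator `s` is
sent to `D_s P_ψ(s)`, where `D_s` has `ζ_m` at `s` and `1` elsewhere on the diagonal. -/
def rep (C : CycleSet S) (m : ℕ) : C.StructureGroup →* GL S ℂ :=
  PresentedGroup.toGroup
    (f := fun s => monomialGL (fun i => if i = s then zeta m else 1) (C.perm s)) (by
      rintro r ⟨s, t, -, rfl⟩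
      simp only [map_mul, map_inv, FreeGroup.lift_apply_of, mul_inv_eq_one, monomialGL_mul]
      rw [C.perm_mul_perm s t]
      congr 1
      funext i
      have h1 : C.perm s i = C.op s t ↔ i = t := (C.bijective_op s).1.eq_iff
      have h2 : C.perm t i = C.op t s ↔ i = s := (C.bijective_op t).1.eq_iff
      simp only [h1, h2, mul_comm])

/-- The germ at level `m`: the image of the structure group under the specialization `q = ζ_m`. All
these groups live in `GL S ℂ`, and since `ζ_k = ζ_{kl} ^ l`, the embedding of the monomial matrices
with coefficients powers of `ζ_k` into those with coefficients powers of `ζ_{kl}` is an inclusion. -/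
def germAt (C : CycleSet S) (m : ℕ) : Subgroup (GL S ℂ) := (C.rep m).range

/-- The germ of `C`, the germ at the level given by the Dehornoy class. -/
def germ (C : CycleSet S) : Subgroup (GL S ℂ) := C.germAt C.dehornoyClass

/-- The subgroup of the germ generated by the images of the `s^[k]`. -/
def germPow (C : CycleSet S) (k : ℕ) : Subgroup (GL S ℂ) :=
  (C.powSubgroup k).map (C.rep C.dehornoyClass)

/-- `C` is the Zappa–Szép product of `A` and `B`: their classes `a`, `b` are coprime, their germs
commute and intersect trivially, and the product of the germs is the germ of `C` at level `ab`
(the class of `C` is a divisor of `ab`). -/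
structure IsZappaSzep (A B C : CycleSet S) : Prop where
  coprime : Nat.Coprime A.dehornoyClass B.dehornoyClass
  commute : (A.germ : Set (GL S ℂ)) * (B.germ : Set (GL S ℂ)) = B.germ * A.germ
  disjoint : A.germ ⊓ B.germ = ⊥
  class_dvd : C.dehornoyClass ∣ A.dehornoyClass * B.dehornoyClass
  germ_eq : (C.germAt (A.dehornoyClass * B.dehornoyClass) : Set (GL S ℂ)) =
    (A.germ : Set (GL S ℂ)) * (B.germ : Set (GL S ℂ))

/-- `C` is the iterated Zappa–Szép product `A₁ ⋈ (A₂ ⋈ (⋯ ⋈ A_r))`; the empty product is the trivial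
cycle set. -/
inductive IsZappaSzepProduct : List (CycleSet S) → CycleSet S → Prop
  | nil : IsZappaSzepProduct [] (trivial S)
  | cons {A B C : CycleSet S} {L : List (CycleSet S)} :
      IsZappaSzepProduct L B → IsZappaSzep A B C → IsZappaSzepProduct (A :: L) C

end

end CycleSet

namespace CycleSet

noncomputable section

variable {S : Type*}

/-! ### Existence of the class -/

/-! The exponents of the monomial representation over powers of `q` form a cocycle `vec : G → ℤ^S`
with `vec (g h) = vec g + vec h ∘ ψ(g)`, and this cocycle is bijective (`bijective_vec`). Hence `ψ`
can be read as a function `lam` on `ℤ^S`, and the theorem becomes arithmetic of exponent vectors.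
The subgroup `G^[k]` corresponds to `k ℤ^S`, and passing to `S^[k]` amounts to replacing `a` by `k
a` (`lam_power`). As `ψ` is trivial on `G^[d]`, `lam` is `d`-periodic (`lam_congr`), so the germ is
a copy of `(ℤ/d)^S` with a twisted product, in which the image of `G^[k]` consists of the multiples
of `k`.

Bézout gives that the images of `G^[j]` and `G^[k]` multiply to that of `G^[gcd(j,k)]`
(`coe_germPow_mul_coe_germPow`), an answer symmetric in `j` and `k`; divisibility gives trivial
intersections (`germPow_inf_germPow`), and counting vectors gives the Sylow property
(`card_germPow`). A germ determines its cycle set, because its element with exponent vector `e_s`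
has permutation `ψ(s)` (`eq_of_germAt_eq`). The explicit reconstruction is a telescoping product of
the `s^[k]` (`bezoutPerm_power`). -/

theorem bpow_add (C : CycleSet S) (j k : ℕ) (s : S) :
    C.bpow (j + k) s = C.bpow j s * C.bpow k (C.psi (C.bpow j s) s) := by
  induction j generalizing s with
  | zero => simp [bpow]
  | succ j ih =>
    rw [Nat.succ_add, bpow, bpow, ih, psi_mul, Equiv.Perm.mul_apply, psi_gen_apply, mul_assoc]
    rfl

theorem psi_bpow_add (C : CycleSet S) (j k : ℕ) (s : S) :
    C.psi (C.bpow (j + k) s) =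
      C.psi (C.bpow k (C.psi (C.bpow j s) s)) * C.psi (C.bpow j s) := by
  rw [bpow_add, psi_mul]

/-- Pigeonhole: `k ↦ (s ↦ ψ(s^[k]))` takes finitely many values, and by `psi_bpow_add` the value at
`k` determines all later ones, so the sequence is eventually periodic. -/
theorem exists_psi_bpow_two_mul [Finite S] (C : CycleSet S) :
    ∃ N, 0 < N ∧ ∀ s, C.psi (C.bpow (N + N) s) = C.psi (C.bpow N s) := by
  obtain ⟨i, j, hij, h⟩ := Finite.exists_ne_map_eq_of_infinite
    (fun k : ℕ => fun s => C.psi (C.bpow k s))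
  wlog hlt : i < j generalizing i j
  · exact this j i hij.symm h.symm (by omega)
  have hshift (m : ℕ) (s : S) : C.psi (C.bpow (i + m) s) = C.psi (C.bpow (j + m) s) := by
    have h' := congrFun h s
    rw [psi_bpow_add, psi_bpow_add, show C.psi (C.bpow i s) = C.psi (C.bpow j s) from h']
  obtain ⟨q, rfl⟩ := Nat.exists_eq_add_of_lt hlt
  have hper (m n : ℕ) (hn : i ≤ n) (s : S) :
      C.psi (C.bpow (n + m * (q + 1)) s) = C.psi (C.bpow n s) := by
    induction m with
    | zero => simp
    | succ m ih =>
      rw [← ih]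
      obtain ⟨r, rfl⟩ := Nat.exists_eq_add_of_le hn
      have := hshift (r + m * (q + 1)) s
      rw [show i + r + m * (q + 1) = i + (r + m * (q + 1)) by ring, this]
      congr 2
      ring
  -- A multiple of the period `q + 1` that lies beyond the preperiod `i`.
  refine ⟨(i + 1) * (q + 1), by positivity, fun s => hper _ _ ?_ s⟩
  nlinarith [Nat.zero_le (i * q)]

theorem psi_bpow_op_eq_one {C : CycleSet S} {N : ℕ} {r : S} (hr : C.psi (C.bpow N r) = 1) (t : S) :
    C.psi (C.bpow N (C.op t r)) = 1 := by
  have h := congrArg C.psi (C.gen_mul_bpow N t r)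
  rw [hr, psi_mul, psi_mul, hr, mul_one, Equiv.Perm.one_apply] at h
  exact mul_eq_right.1 h

/-- Let `R` be the set of `r` with `ψ(r^[N]) = 1`. Idempotence at `N` puts `T^N(s)` in `R`. Each
`ψ(t)` maps the finite set `R` injectively to itself, hence onto itself, so membership pulls back
along `T(s) = ψ(s)(s)` from `T^N(s)` to `s`. -/
theorem exists_class [Finite S] (C : CycleSet S) :
    ∃ N, 0 < N ∧ ∀ s, C.psi (C.bpow N s) = 1 := by
  obtain ⟨N, hN, h⟩ := C.exists_psi_bpow_two_mul
  refine ⟨N, hN, ?_⟩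
  have hfix (s : S) : C.psi (C.bpow N (C.psi (C.bpow N s) s)) = 1 := by
    have := h s
    rw [psi_bpow_add] at this
    exact mul_eq_right.1 this
  have hback (t r : S) (hr : C.psi (C.bpow N (C.op t r)) = 1) : C.psi (C.bpow N r) = 1 := by
    let R : Set S := {r | C.psi (C.bpow N r) = 1}
    have hm : Set.MapsTo (C.op t) R R := fun r hr => psi_bpow_op_eq_one hr t
    obtain ⟨⟨r', hr'⟩, he⟩ := Finite.surjective_of_injective
      (hm.restrict_inj.2 (C.bijective_op t).1.injOn) ⟨C.op t r, hr⟩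
    exact (C.bijective_op t).1 (congrArg Subtype.val he) ▸ hr'
  have hdiag (k : ℕ) (s : S) (hs : C.psi (C.bpow N (C.psi (C.bpow k s) s)) = 1) :
      C.psi (C.bpow N s) = 1 := by
    induction k generalizing s with
    | zero => simpa [bpow] using hs
    | succ k ih =>
      rw [bpow, psi_mul, Equiv.Perm.mul_apply, psi_gen_apply] at hs
      exact hback s s (ih (C.diag s) hs)
  exact fun s => hdiag N s (hfix s)

theorem dehornoyClass_spec [Finite S] (C : CycleSet S) :
    0 < C.dehornoyClass ∧ ∀ s, C.psi (C.bpow C.dehornoyClass s) = 1 :=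
  Nat.sInf_mem (s := {d : ℕ | 0 < d ∧ ∀ s, C.psi (C.bpow d s) = 1}) C.exists_class

theorem psi_bpow_mod [Finite S] (C : CycleSet S) (n : ℕ) (s : S) :
    C.psi (C.bpow (n % C.dehornoyClass) s) = C.psi (C.bpow n s) := by
  have hmul (k : ℕ) : C.psi (C.bpow (C.dehornoyClass * k) s) = 1 := by
    induction k with
    | zero => simp [bpow]
    | succ k ih => rw [mul_add, mul_one, psi_bpow_add, ih, C.dehornoyClass_spec.2, one_mul]
  conv_rhs => rw [← Nat.div_add_mod n C.dehornoyClass, psi_bpow_add, hmul]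
  simp

theorem dehornoyClass_dvd_iff [Finite S] (C : CycleSet S) (n : ℕ) :
    C.dehornoyClass ∣ n ↔ ∀ s, C.psi (C.bpow n s) = 1 := by
  constructor
  · intro h s
    rw [← psi_bpow_mod, Nat.mod_eq_zero_of_dvd h]
    simp [bpow]
  · intro h
    by_contra hn
    refine Nat.notMem_of_lt_sInf (Nat.mod_lt n C.dehornoyClass_spec.1)
      ⟨Nat.pos_of_ne_zero fun h0 => hn (Nat.dvd_of_mod_eq_zero h0), fun s => ?_⟩
    exact (C.psi_bpow_mod n s).trans (h s)

/-! ### The bijective cocycle -/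

/-- Monomial matrices over `ℤ[q, q⁻¹]` with coefficients powers of `q`: an exponent vector together
with a permutation. -/
@[ext]
structure IntMonomial (S : Type*) where
  vec : S → ℤ
  perm : Equiv.Perm S

/-- Permutations multiply in reverse order, as in `monomialGL_mul`, to match `ψ(gh) = ψ(h) ∘ ψ(g)`.
-/
instance : Group (IntMonomial S) where
  mul x y := ⟨x.vec + y.vec ∘ x.perm, y.perm * x.perm⟩
  one := ⟨0, 1⟩
  inv x := ⟨-(x.vec ∘ ⇑x.perm⁻¹), x.perm⁻¹⟩
  mul_assoc x y z := by
    refine IntMonomial.ext ?_ (mul_assoc _ _ _).symm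
    exact add_assoc _ _ _
  one_mul x := IntMonomial.ext (zero_add _) (mul_one _)
  mul_one x := IntMonomial.ext (add_zero _) (one_mul _)
  inv_mul_cancel x := IntMonomial.ext (neg_add_cancel (x.vec ∘ ⇑x.perm⁻¹)) (mul_inv_cancel _)

@[simp] theorem IntMonomial.mul_vec (x y : IntMonomial S) :
    (x * y).vec = x.vec + y.vec ∘ x.perm := rfl

@[simp] theorem IntMonomial.mul_perm (x y : IntMonomial S) :
    (x * y).perm = y.perm * x.perm := rfl

@[simp] theorem IntMonomial.one_vec : (1 : IntMonomial S).vec = 0 := rfl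

@[simp] theorem IntMonomial.one_perm : (1 : IntMonomial S).perm = 1 := rfl

theorem psi_gen (C : CycleSet S) (s : S) : C.psi (C.gen s) = C.perm s := by
  ext t
  exact C.psi_gen_apply s t

theorem closure_range_gen (C : CycleSet S) : Subgroup.closure (Set.range C.gen) = ⊤ :=
  PresentedGroup.closure_range_of C.rels

/-- The map `g ↦ g ψ(g)(s)`, which adds the basis vector `s` to the exponent vector. -/
def incr (C : CycleSet S) (s : S) (g : C.StructureGroup) : C.StructureGroup :=
  g * C.gen (C.psi g s)

theorem incr_comm (C : CycleSet S) (s t : S) (g : C.StructureGroup) :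
    C.incr s (C.incr t g) = C.incr t (C.incr s g) := by
  simp only [incr, psi_mul, Equiv.Perm.mul_apply, psi_gen_apply, mul_assoc]
  rw [gen_mul_gen]

theorem incr_iterate (C : CycleSet S) (s : S) (g : C.StructureGroup) (k : ℕ) :
    (C.incr s)^[k] g = g * C.bpow k (C.psi g s) := by
  induction k generalizing g with
  | zero => simp [bpow]
  | succ k ih =>
    rw [Function.iterate_succ_apply, ih, incr, bpow, psi_mul, Equiv.Perm.mul_apply, psi_gen_apply,
      mul_assoc]
    rfl

/-- The `d`-th iterate multiplies `g` by `(ψ(g)(s))^[d]`, which has trivial permutation. So `ψ(g)`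
survives in the result, and `g` is recovered by dividing. A map with a bijective positive iterate is
bijective. -/
theorem bijective_incr [Finite S] (C : CycleSet S) (s : S) : Function.Bijective (C.incr s) := by
  have hd := C.dehornoyClass_spec
  have hb : Function.Bijective (C.incr s)^[C.dehornoyClass] := by
    constructor
    · intro g h hgh
      rw [incr_iterate, incr_iterate] at hgh
      have hp := congrArg C.psi hgh
      rw [psi_mul, psi_mul, hd.2, hd.2, one_mul, one_mul] at hp
      rwa [hp, mul_left_inj] at hgh
    · intro h
      refine ⟨h * (C.bpow C.dehornoyClass (C.psi h s))⁻¹, ?_⟩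
      have hi : C.psi (C.bpow C.dehornoyClass (C.psi h s))⁻¹ = 1 := by
        have := hd.2 (C.psi h s)
        simp only [psi, MulOpposite.unop_eq_one_iff] at this ⊢
        rw [map_inv, this, inv_one]
      rw [incr_iterate, psi_mul, hi, one_mul, inv_mul_cancel_right]
  obtain ⟨n, hn⟩ := Nat.exists_eq_succ_of_ne_zero hd.1.ne'
  rw [hn] at hb
  constructor
  · refine Function.Injective.of_comp (f := (C.incr s)^[n]) ?_
    rw [← Function.iterate_succ]
    exact hb.1
  · refine Function.Surjective.of_comp (g := (C.incr s)^[n]) ?_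
    rw [← Function.iterate_succ']
    exact hb.2

/-- `incr` as a permutation of the structure group. -/
def incrPerm [Finite S] (C : CycleSet S) (s : S) : Equiv.Perm C.StructureGroup :=
  Equiv.ofBijective _ (C.bijective_incr s)

theorem pairwise_commute_zpowersHom_incrPerm [Finite S] (C : CycleSet S) :
    Pairwise fun s t => ∀ x y : Multiplicative ℤ,
      Commute (zpowersHom _ (C.incrPerm s) x) (zpowersHom _ (C.incrPerm t) y) := by
  intro s t _ x y
  have h : Commute (C.incrPerm s) (C.incrPerm t) := Equiv.ext fun g => C.incr_comm s t g
  simpa only [zpowersHom_apply] using h.zpow_zpow _ _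

variable [DecidableEq S]

theorem single_comp_perm (σ : Equiv.Perm S) (s : S) (n : ℤ) :
    (Pi.single (σ s) n : S → ℤ) ∘ σ = Pi.single s n := by
  ext i
  simp [Pi.single_apply]

/-- The faithful monomial representation of the structure group, with coefficients powers of `q`. -/
def intRep (C : CycleSet S) : C.StructureGroup →* IntMonomial S :=
  PresentedGroup.toGroup (f := fun s => (⟨Pi.single s 1, C.perm s⟩ : IntMonomial S)) (by
    rintro r ⟨s, t, -, rfl⟩
    simp only [map_mul, map_inv, FreeGroup.lift_apply_of, mul_inv_eq_one]
    refine IntMonomial.ext ?_ (C.perm_mul_perm s t)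
    have h (x y : S) : (Pi.single (C.op x y) 1 : S → ℤ) ∘ C.perm x = Pi.single y 1 :=
      single_comp_perm (C.perm x) y 1
    simp only [IntMonomial.mul_vec, h, add_comm])

/-- The cocycle `G → ℤ^S` given by the exponents of the monomial representation. -/
def vec (C : CycleSet S) (g : C.StructureGroup) : S → ℤ := (C.intRep g).vec

theorem intRep_gen (C : CycleSet S) (s : S) : C.intRep (C.gen s) = ⟨Pi.single s 1, C.perm s⟩ := by
  simp [intRep, gen]

theorem intRep_perm (C : CycleSet S) (g : C.StructureGroup) : (C.intRep g).perm = C.psi g := by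
  let f : IntMonomial S →* (Equiv.Perm S)ᵐᵒᵖ :=
    { toFun x := MulOpposite.op x.perm, map_one' := rfl, map_mul' _ _ := rfl }
  have : f.comp C.intRep = C.psiHom := by
    refine PresentedGroup.ext fun s => ?_
    exact congrArg f (C.intRep_gen s) |>.trans (congrArg MulOpposite.op (C.psi_gen s).symm)
  exact congrArg MulOpposite.unop (DFunLike.congr_fun this g)

@[simp]
theorem vec_one (C : CycleSet S) : C.vec 1 = 0 := by simp [vec]

@[simp]
theorem vec_mul (C : CycleSet S) (g h : C.StructureGroup) :
    C.vec (g * h) = C.vec g + C.vec h ∘ C.psi g := by simp [vec, intRep_perm]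

@[simp]
theorem vec_gen (C : CycleSet S) (s : S) : C.vec (C.gen s) = Pi.single s 1 := by
  simp [vec, intRep_gen]

@[simp]
theorem vec_bpow (C : CycleSet S) (k : ℕ) (s : S) : C.vec (C.bpow k s) = Pi.single s (k : ℤ) := by
  induction k generalizing s with
  | zero => simp [bpow]
  | succ k ih =>
    have h : C.diag s = C.psi (C.gen s) s := (C.psi_gen_apply s s).symm
    rw [bpow, vec_mul, ih, vec_gen, h, single_comp_perm, ← Pi.single_add]
    congr 1
    push_cast
    ring

theorem vec_incr (C : CycleSet S) (s : S) (g : C.StructureGroup) :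
    C.vec (C.incr s g) = C.vec g + Pi.single s 1 := by
  rw [incr, vec_mul, vec_gen, single_comp_perm]

/-- The action of `ℤ^S` on the structure group by translation of the exponent vector. -/
def translate [Fintype S] (C : CycleSet S) :
    (S → Multiplicative ℤ) →* Equiv.Perm C.StructureGroup :=
  MonoidHom.noncommPiCoprod _ C.pairwise_commute_zpowersHom_incrPerm

theorem translate_mulSingle [Fintype S] (C : CycleSet S) (s : S) (n : ℤ) :
    C.translate (Pi.mulSingle s (Multiplicative.ofAdd n)) = C.incrPerm s ^ n := by
  rw [translate, MonoidHom.noncommPiCoprod_mulSingle, zpowersHom_apply, toAdd_ofAdd]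

theorem vec_zpow_incrPerm [Finite S] (C : CycleSet S) (s : S) (n : ℤ) (g : C.StructureGroup) :
    C.vec ((C.incrPerm s ^ n) g) = C.vec g + Pi.single s n := by
  induction n generalizing g with
  | zero => simp
  | succ n ih =>
    rw [zpow_add_one, Equiv.Perm.mul_apply, ih, incrPerm, Equiv.ofBijective_apply, vec_incr,
      add_comm (n : ℤ) 1, Pi.single_add, add_assoc]
  | pred n ih =>
    have h := C.vec_incr s ((C.incrPerm s)⁻¹ g)
    have h' : C.incr s ((C.incrPerm s)⁻¹ g) = g := (C.incrPerm s).apply_symm_apply g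
    rw [h'] at h
    rw [zpow_sub_one, Equiv.Perm.mul_apply, ih, h, Pi.single_sub]
    abel

theorem vec_translate [Fintype S] (C : CycleSet S) (a : S → Multiplicative ℤ)
    (g : C.StructureGroup) :
    C.vec (C.translate a g) = C.vec g + fun s => (a s).toAdd := by
  -- The formula is compatible with products in `a`, so it suffices to check it on coordinate
  -- vectors.
  let K : Submonoid (S → Multiplicative ℤ) :=
    { carrier := {a | ∀ g, C.vec (C.translate a g) = C.vec g + fun s => (a s).toAdd}
      one_mem' g := by
        rw [map_one]
        exact (add_zero _).symm
      mul_mem' {a b} ha hb g := by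
        rw [map_mul, Equiv.Perm.mul_apply, ha, hb, add_assoc, add_comm (fun s => (b s).toAdd)]
        rfl }
  have hK : a ∈ K := by
    rw [← Finset.univ_prod_mulSingle a]
    refine K.prod_mem fun s _ g => ?_
    have h := C.vec_zpow_incrPerm s (a s).toAdd g
    rw [← translate_mulSingle, ofAdd_toAdd] at h
    rw [h]
    congr 1
  exact hK g

/-- The translation action is transitive: right multiplication of `x` by a generator `t` is the
increment at `ψ(x)⁻¹(t)`, and right multiplication by its inverse undoes an increment. -/
theorem exists_translate_eq [Fintype S] (C : CycleSet S) (g : C.StructureGroup) :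
    ∃ a, C.translate a 1 = g := by
  have hg : g ∈ Subgroup.closure (Set.range C.gen) := by
    rw [closure_range_gen]
    exact Subgroup.mem_top g
  have hone (s : S) : C.translate (Pi.mulSingle s (Multiplicative.ofAdd 1)) = C.incrPerm s := by
    rw [translate_mulSingle, zpow_one]
  induction hg using Subgroup.closure_induction_right with
  | one => exact ⟨1, by simp⟩
  | mul_right x hx y hy ih =>
    obtain ⟨t, rfl⟩ := hy
    obtain ⟨a, ha⟩ := ih
    refine ⟨Pi.mulSingle ((C.psi x).symm t) (Multiplicative.ofAdd 1) * a, ?_⟩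
    rw [map_mul, hone, Equiv.Perm.mul_apply, ha, incrPerm, Equiv.ofBijective_apply, incr,
      Equiv.apply_symm_apply]
  | mul_inv_cancel x hx y hy ih =>
    obtain ⟨t, rfl⟩ := hy
    obtain ⟨a, ha⟩ := ih
    set z := x * (C.gen t)⁻¹ with hz
    -- The index uses `ψ(z)` and not `ψ(x)`, since it is the increment of `z` that has to give `x`.
    refine ⟨(Pi.mulSingle ((C.psi z).symm t) (Multiplicative.ofAdd 1))⁻¹ * a, ?_⟩
    rw [map_mul, map_inv, hone, Equiv.Perm.mul_apply, ha, Equiv.Perm.inv_eq_iff_eq, incrPerm,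
      Equiv.ofBijective_apply, incr, Equiv.apply_symm_apply, hz, inv_mul_cancel_right]

/-- Every element is the translate of `1` by some `a`, and its exponent vector is that `a`. -/
theorem bijective_vec [Fintype S] (C : CycleSet S) : Function.Bijective C.vec := by
  constructor
  · intro g h hgh
    obtain ⟨a, rfl⟩ := C.exists_translate_eq g
    obtain ⟨b, rfl⟩ := C.exists_translate_eq h
    rw [vec_translate, vec_translate, add_right_inj] at hgh
    have : a = b := funext fun s => Multiplicative.toAdd.injective (congrFun hgh s)
    rw [this]
  · intro a
    refine ⟨C.translate (fun s => Multiplicative.ofAdd (a s)) 1, ?_⟩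
    rw [vec_translate, vec_one, zero_add]
    rfl

end

end CycleSet

namespace CycleSet

noncomputable section

variable {S : Type*}

/-! ### Powers of a cycle set -/

/-- The morphism from the structure group of `S^[k]` to that of `S` sending `s` to `s^[k]`. -/
def powerHom (C : CycleSet S) (k : ℕ) : (C.power k).StructureGroup →* C.StructureGroup :=
  PresentedGroup.toGroup (f := C.bpow k) (by
    rintro r ⟨s, t, -, rfl⟩
    simp only [map_mul, map_inv, FreeGroup.lift_apply_of, mul_inv_eq_one]
    exact C.bpow_mul_bpow k k s t)

theorem powerHom_gen (C : CycleSet S) (k : ℕ) (s : S) :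
    C.powerHom k ((C.power k).gen s) = C.bpow k s := by
  simp [powerHom, gen]

theorem range_powerHom (C : CycleSet S) (k : ℕ) : (C.powerHom k).range = C.powSubgroup k := by
  rw [MonoidHom.range_eq_map, ← closure_range_gen, MonoidHom.map_closure, ← Set.range_comp,
    powSubgroup]
  congr 2
  exact funext (C.powerHom_gen k)

theorem psi_powerHom (C : CycleSet S) (k : ℕ) (g : (C.power k).StructureGroup) :
    C.psi (C.powerHom k g) = (C.power k).psi g := by
  have : C.psiHom.comp (C.powerHom k) = (C.power k).psiHom := by
    refine PresentedGroup.ext fun s => MulOpposite.unop_injective (Equiv.ext fun t => ?_)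
    exact (congrArg (fun g => C.psi g t) (C.powerHom_gen k s)).trans
      ((C.power k).psi_gen_apply s t).symm
  exact congrArg MulOpposite.unop (DFunLike.congr_fun this g)

theorem power_one (C : CycleSet S) : C.power 1 = C := by
  ext s t
  simp [power, bpow]

theorem power_dehornoyClass [Finite S] (C : CycleSet S) :
    C.power C.dehornoyClass = trivial S := by
  ext s t
  simp [power, trivial, C.dehornoyClass_spec.2]

theorem psi_of_mem_powSubgroup [Finite S] {C : CycleSet S} {g : C.StructureGroup}
    (hg : g ∈ C.powSubgroup C.dehornoyClass) : C.psi g = 1 := by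
  have h : C.powSubgroup C.dehornoyClass ≤ C.psiHom.ker := by
    rw [powSubgroup, Subgroup.closure_le]
    rintro _ ⟨s, rfl⟩
    exact MulOpposite.unop_injective (C.dehornoyClass_spec.2 s)
  exact congrArg MulOpposite.unop (h hg)

theorem exists_eq_add_smul {m : ℤ} {a b : S → ℤ} (h : ∀ i, m ∣ a i - b i) :
    ∃ c : S → ℤ, a = b + m • c := by
  choose c hc using h
  refine ⟨c, funext fun i => ?_⟩
  have := hc i
  simp only [Pi.add_apply, Pi.smul_apply, smul_eq_mul]
  linarith

variable [DecidableEq S]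

theorem vec_powerHom (C : CycleSet S) (k : ℕ) (g : (C.power k).StructureGroup) :
    C.vec (C.powerHom k g) = (k : ℤ) • (C.power k).vec g := by
  let f : IntMonomial S →* IntMonomial S :=
    { toFun x := ⟨(k : ℤ) • x.vec, x.perm⟩
      map_one' := IntMonomial.ext (smul_zero _) rfl
      map_mul' x y := IntMonomial.ext (smul_add _ _ _) rfl }
  have : C.intRep.comp (C.powerHom k) = f.comp (C.power k).intRep := by
    refine PresentedGroup.ext fun s => ?_
    change C.intRep (C.powerHom k ((C.power k).gen s)) = f ((C.power k).intRep ((C.power k).gen s))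
    rw [powerHom_gen, intRep_gen]
    refine IntMonomial.ext ?_ ?_
    · refine (C.vec_bpow k s).trans ?_
      change _ = (k : ℤ) • (Pi.single s 1 : S → ℤ)
      rw [← Pi.single_smul]
      simp
    · rw [intRep_perm]
      exact Equiv.ext fun t => rfl
  exact congrArg IntMonomial.vec (DFunLike.congr_fun this g)

variable [Fintype S]

/-- The permutation `ψ(g)` of the unique element `g` of the structure group with exponent vector
`a`. -/
def lam (C : CycleSet S) (a : S → ℤ) : Equiv.Perm S :=
  C.psi ((Equiv.ofBijective _ C.bijective_vec).symm a)

theorem lam_vec (C : CycleSet S) (g : C.StructureGroup) : C.lam (C.vec g) = C.psi g :=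
  congrArg C.psi ((Equiv.ofBijective _ C.bijective_vec).symm_apply_apply g)

theorem lam_add (C : CycleSet S) (a b : S → ℤ) :
    C.lam (a + b ∘ C.lam a) = C.lam b * C.lam a := by
  obtain ⟨g, rfl⟩ := C.bijective_vec.2 a
  obtain ⟨h, rfl⟩ := C.bijective_vec.2 b
  rw [lam_vec, lam_vec, ← vec_mul, lam_vec, psi_mul]

theorem lam_zero (C : CycleSet S) : C.lam 0 = 1 := by
  rw [← C.vec_one, lam_vec, psi_one]

theorem lam_single (C : CycleSet S) (s : S) (n : ℕ) :
    C.lam (Pi.single s (n : ℤ)) = C.psi (C.bpow n s) := by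
  rw [← vec_bpow, lam_vec]

theorem lam_power (C : CycleSet S) (k : ℕ) (a : S → ℤ) :
    (C.power k).lam a = C.lam ((k : ℤ) • a) := by
  obtain ⟨g, rfl⟩ := (C.power k).bijective_vec.2 a
  rw [lam_vec, ← vec_powerHom, lam_vec, psi_powerHom]

/-- Surjectivity of the cocycle of `S^[k]`, transported by `powerHom`, which scales exponents by
`k`. -/
theorem exists_mem_powSubgroup (C : CycleSet S) (k : ℕ) (a : S → ℤ) :
    ∃ g ∈ C.powSubgroup k, C.vec g = (k : ℤ) • a := by
  obtain ⟨g, rfl⟩ := (C.power k).bijective_vec.2 a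
  refine ⟨C.powerHom k g, ?_, C.vec_powerHom k g⟩
  rw [← range_powerHom]
  exact ⟨g, rfl⟩

/-- Left multiplication by the element of `G^[d]` with vector `d b` is an untwisted translation and
leaves `ψ` unchanged. -/
theorem lam_add_smul (C : CycleSet S) (a b : S → ℤ) :
    C.lam (a + (C.dehornoyClass : ℤ) • b) = C.lam a := by
  obtain ⟨g, rfl⟩ := C.bijective_vec.2 a
  obtain ⟨h, hh, hb⟩ := C.exists_mem_powSubgroup C.dehornoyClass b
  have hp := psi_of_mem_powSubgroup hh
  have : C.vec (h * g) = C.vec g + (C.dehornoyClass : ℤ) • b := by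
    rw [vec_mul, hp, hb, add_comm]
    rfl
  rw [← this, lam_vec, lam_vec, psi_mul, hp, mul_one]

theorem lam_congr (C : CycleSet S) {m : ℕ} (hm : C.dehornoyClass ∣ m) {a b : S → ℤ}
    (h : ∀ i, (m : ℤ) ∣ a i - b i) : C.lam a = C.lam b := by
  obtain ⟨c, rfl⟩ := exists_eq_add_smul fun i => (Int.natCast_dvd_natCast.2 hm).trans (h i)
  exact C.lam_add_smul b c

theorem psi_bpow_power (C : CycleSet S) (k u : ℕ) (s : S) :
    (C.power k).psi ((C.power k).bpow u s) = C.psi (C.bpow (k * u) s) := by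
  rw [← lam_single, ← lam_single, lam_power, ← Pi.single_smul]
  simp

theorem dehornoyClass_power (C : CycleSet S) {k m : ℕ} (h : C.dehornoyClass = k * m) :
    (C.power k).dehornoyClass = m := by
  have hk : 0 < k := Nat.pos_of_ne_zero fun h0 => by
    have := C.dehornoyClass_spec.1
    simp [h, h0] at this
  refine Nat.dvd_antisymm ?_ ?_
  · rw [dehornoyClass_dvd_iff]
    intro s
    rw [psi_bpow_power, ← h, C.dehornoyClass_spec.2]
  · refine Nat.dvd_of_mul_dvd_mul_left hk ?_
    rw [← h, dehornoyClass_dvd_iff]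
    intro s
    rw [← psi_bpow_power, (C.power k).dehornoyClass_spec.2]

/-! ### Monomial matrices -/

theorem monomialGL_apply (c : S → ℂˣ) (σ : Equiv.Perm S) (i j : S) :
    (monomialGL c σ).val i j = if σ i = j then (c i : ℂ) else 0 := by
  simp [monomialGL, Matrix.diagonal_mul, Equiv.Perm.permMatrix, PEquiv.toMatrix_apply, eq_comm]

theorem monomialGL_injective {c c' : S → ℂˣ} {σ σ' : Equiv.Perm S}
    (h : monomialGL c σ = monomialGL c' σ') : c = c' ∧ σ = σ' := by
  have h' (i : S) : σ' i = σ i ∧ c i = c' i := by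
    have hi := congrArg (fun x : GL S ℂ => x.val i (σ i)) h
    simp only [monomialGL_apply, if_true] at hi
    by_cases hs : σ' i = σ i
    · rw [if_pos hs] at hi
      exact ⟨hs, Units.ext hi⟩
    · rw [if_neg hs] at hi
      exact absurd hi (c i).ne_zero
  exact ⟨funext fun i => (h' i).2, Equiv.ext fun i => (h' i).1.symm⟩

theorem monomialGL_one : monomialGL (1 : S → ℂˣ) 1 = 1 := by
  ext i j
  rw [monomialGL_apply]
  by_cases h : i = j <;> simp [h]

theorem isPrimitiveRoot_zeta {m : ℕ} (hm : m ≠ 0) : IsPrimitiveRoot (zeta m) m :=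
  IsPrimitiveRoot.coe_units_iff.1 (Complex.isPrimitiveRoot_exp m hm)

theorem zeta_zpow_eq_iff {m : ℕ} (hm : m ≠ 0) (a b : ℤ) :
    zeta m ^ a = zeta m ^ b ↔ (m : ℤ) ∣ a - b := by
  rw [← (isPrimitiveRoot_zeta hm).zpow_eq_one_iff_dvd, zpow_sub, mul_inv_eq_one]

theorem zeta_mul_pow {k : ℕ} (hk : k ≠ 0) (m : ℕ) : zeta (k * m) ^ k = zeta m := by
  refine Units.ext ?_
  change Complex.exp _ ^ k = Complex.exp _
  rw [← Complex.exp_nat_mul]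
  congr 1
  have : (k : ℂ) ≠ 0 := Nat.cast_ne_zero.2 hk
  push_cast
  rw [← mul_div_assoc, mul_div_mul_left _ _ this]

/-- Specialization of `q` at `ζ_m`. -/
def specializeAt (m : ℕ) : IntMonomial S →* GL S ℂ where
  toFun x := monomialGL (fun i => zeta m ^ x.vec i) x.perm
  map_one' := by simpa using! monomialGL_one
  map_mul' x y := by
    rw [monomialGL_mul]
    congr 1
    funext i
    exact zpow_add _ _ _

theorem rep_eq (C : CycleSet S) (m : ℕ) (g : C.StructureGroup) :
    C.rep m g = monomialGL (fun i => zeta m ^ C.vec g i) (C.psi g) := by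
  have : C.rep m = (specializeAt m).comp C.intRep := by
    refine PresentedGroup.ext fun s => ?_
    change _ = specializeAt m (C.intRep (C.gen s))
    rw [intRep_gen, rep, PresentedGroup.toGroup.of]
    change _ = monomialGL _ _
    congr 1
    funext i
    by_cases h : i = s
    · subst h; simp
    · simp [h]
  rw [this, ← intRep_perm]
  rfl

/-- An element of the kernel has exponent vector in `d ℤ^S`. Some element of `G^[d]` has the same
vector, and injectivity of `vec` identifies the two. -/
theorem ker_rep_dehornoyClass (C : CycleSet S) :
    (C.rep C.dehornoyClass).ker = C.powSubgroup C.dehornoyClass := by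
  have hd := C.dehornoyClass_spec.1.ne'
  refine le_antisymm (fun g hg => ?_) ?_
  · rw [MonoidHom.mem_ker, rep_eq, ← monomialGL_one] at hg
    have hc := (monomialGL_injective hg).1
    obtain ⟨b, hb⟩ : ∃ b, C.vec g = 0 + (C.dehornoyClass : ℤ) • b := by
      refine exists_eq_add_smul fun i => (zeta_zpow_eq_iff hd _ _).1 ?_
      simpa using congrFun hc i
    obtain ⟨h, hh, he⟩ := C.exists_mem_powSubgroup C.dehornoyClass b
    rw [zero_add, ← he] at hb
    rwa [C.bijective_vec.1 hb]
  · rw [powSubgroup, Subgroup.closure_le]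
    rintro _ ⟨s, rfl⟩
    rw [SetLike.mem_coe, MonoidHom.mem_ker, rep_eq, C.dehornoyClass_spec.2, ← monomialGL_one]
    congr 1
    funext i
    rw [Pi.one_apply, ← zpow_zero (zeta C.dehornoyClass), zeta_zpow_eq_iff hd, vec_bpow, sub_zero,
      Pi.single_apply]
    split_ifs <;> simp

/-! ### The germ and its subgroups -/

/-- The element of the germ at level `m` with exponent vector `a`. -/
def germElt (C : CycleSet S) (m : ℕ) (a : S → ℤ) : GL S ℂ :=
  monomialGL (fun i => zeta m ^ a i) (C.lam a)

theorem rep_eq_germElt (C : CycleSet S) (m : ℕ) (g : C.StructureGroup) :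
    C.rep m g = C.germElt m (C.vec g) := by
  rw [rep_eq, germElt, lam_vec]

theorem mem_germAt (C : CycleSet S) (m : ℕ) (x : GL S ℂ) :
    x ∈ C.germAt m ↔ ∃ a, C.germElt m a = x := by
  constructor
  · rintro ⟨g, rfl⟩
    exact ⟨_, (C.rep_eq_germElt m g).symm⟩
  · rintro ⟨a, rfl⟩
    obtain ⟨g, rfl⟩ := C.bijective_vec.2 a
    exact ⟨g, C.rep_eq_germElt m g⟩

theorem mem_germPow (C : CycleSet S) (k : ℕ) (x : GL S ℂ) :
    x ∈ C.germPow k ↔ ∃ a : S → ℤ, C.germElt C.dehornoyClass ((k : ℤ) • a) = x := by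
  rw [germPow, ← range_powerHom]
  constructor
  · rintro ⟨_, ⟨g, rfl⟩, rfl⟩
    exact ⟨_, by rw [rep_eq_germElt, vec_powerHom]⟩
  · rintro ⟨a, rfl⟩
    obtain ⟨g, rfl⟩ := (C.power k).bijective_vec.2 a
    exact ⟨_, ⟨g, rfl⟩, by rw [rep_eq_germElt, vec_powerHom]⟩

theorem germElt_mul (C : CycleSet S) (m : ℕ) (a b : S → ℤ) :
    C.germElt m a * C.germElt m b = C.germElt m (a + b ∘ C.lam a) := by
  rw [germElt, germElt, germElt, monomialGL_mul, lam_add]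
  congr 1
  funext i
  exact (zpow_add _ _ _).symm

theorem germElt_eq_iff (C : CycleSet S) {m : ℕ} (hm : C.dehornoyClass ∣ m) (h0 : m ≠ 0)
    (a b : S → ℤ) : C.germElt m a = C.germElt m b ↔ ∀ i, (m : ℤ) ∣ a i - b i := by
  constructor
  · intro h i
    exact (zeta_zpow_eq_iff h0 _ _).1 (congrFun (monomialGL_injective h).1 i)
  · intro h
    rw [germElt, germElt, C.lam_congr hm h]
    congr 1
    exact funext fun i => (zeta_zpow_eq_iff h0 _ _).2 (h i)

theorem germElt_zero (C : CycleSet S) (m : ℕ) : C.germElt m 0 = 1 := by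
  rw [germElt, lam_zero, ← monomialGL_one]
  congr 1

theorem germPow_one (C : CycleSet S) : C.germPow 1 = C.germ := by
  ext x
  simp [mem_germPow, germ, mem_germAt]

/-- Scaling exponents by `k` at level `km` is the same as working at level `m`, as `ζ_{km}^k = ζ_m`.
-/
theorem germ_power (C : CycleSet S) {k m : ℕ} (h : C.dehornoyClass = k * m) :
    (C.power k).germ = C.germPow k := by
  have hk : k ≠ 0 := fun h0 => by
    have := C.dehornoyClass_spec.1
    simp [h, h0] at this
  ext x
  rw [germ, mem_germAt, mem_germPow, C.dehornoyClass_power h, h]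
  refine exists_congr fun a => ?_
  rw [germElt, germElt, lam_power, ← zeta_mul_pow hk m]
  simp only [← zpow_natCast, ← zpow_mul, Pi.smul_apply, smul_eq_mul]

theorem coe_germPow_mul_coe_germPow (C : CycleSet S) (j k : ℕ) :
    (C.germPow j : Set (GL S ℂ)) * (C.germPow k : Set (GL S ℂ)) = C.germPow (j.gcd k) := by
  ext x
  simp only [Set.mem_mul, SetLike.mem_coe, mem_germPow]
  constructor
  · rintro ⟨_, ⟨a, rfl⟩, _, ⟨b, rfl⟩, rfl⟩
    obtain ⟨j', hj⟩ := Nat.gcd_dvd_left j k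
    obtain ⟨k', hk⟩ := Nat.gcd_dvd_right j k
    refine ⟨(j' : ℤ) • a + (k' : ℤ) • (b ∘ C.lam ((j : ℤ) • a)), ?_⟩
    rw [germElt_mul, smul_add, smul_smul, smul_smul, ← Nat.cast_mul, ← Nat.cast_mul, ← hj, ← hk]
    rfl
  · rintro ⟨a, rfl⟩
    set c : S → ℤ := j.gcdA k • a with hc
    -- Bézout splits `gcd(j,k) a`; the inverse permutation cancels the twist that the first factor
    -- puts on the second.
    refine ⟨_, ⟨c, rfl⟩, _, ⟨(j.gcdB k • a) ∘ (C.lam ((j : ℤ) • c)).symm, rfl⟩, ?_⟩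
    rw [germElt_mul, Nat.gcd_eq_gcd_ab, add_smul, hc, smul_smul]
    congr 2
    funext i
    simp [mul_assoc]

theorem germPow_inf_germPow (C : CycleSet S) {j k m n : ℕ} (hj : C.dehornoyClass = j * m)
    (hk : C.dehornoyClass = k * n) (hmn : m.Coprime n) : C.germPow j ⊓ C.germPow k = ⊥ := by
  have hd := C.dehornoyClass_spec.1.ne'
  have hk0 : (k : ℤ) ≠ 0 := by
    rintro h0
    rw [Nat.cast_eq_zero] at h0
    simp [hk, h0] at hd
  rw [eq_bot_iff]
  rintro x ⟨hxj, hxk⟩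
  obtain ⟨a, ha⟩ := (C.mem_germPow j x).1 hxj
  obtain ⟨b, rfl⟩ := (C.mem_germPow k x).1 hxk
  rw [germElt_eq_iff C dvd_rfl hd] at ha
  rw [Subgroup.mem_bot, ← C.germElt_zero C.dehornoyClass, germElt_eq_iff C dvd_rfl hd]
  intro i
  have h1 := ha i
  simp only [Pi.smul_apply, smul_eq_mul, Pi.zero_apply, sub_zero] at h1 ⊢
  -- The entry is congruent to `j a i`, which `m` kills modulo `d = jm`. Since also `d = kn` with
  -- `n` prime to `m`, the factor `m` can be cancelled.
  have h2 : (C.dehornoyClass : ℤ) ∣ m * (k * b i) := by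
    have h3 : (C.dehornoyClass : ℤ) ∣ j * m * a i := by
      rw [hj, Nat.cast_mul]
      exact dvd_mul_right _ _
    have := h3.sub (h1.mul_left (m : ℤ))
    rwa [show (j : ℤ) * m * a i - m * (j * a i - k * b i) = m * (k * b i) by ring] at this
  rw [hk, Nat.cast_mul] at h2 ⊢
  rw [mul_left_comm] at h2
  exact mul_dvd_mul_left _ ((Nat.isCoprime_iff_coprime.2 hmn.symm).dvd_of_dvd_mul_left
    ((mul_dvd_mul_iff_left hk0).1 h2))

/-- Elements correspond to `k ℤ^S` modulo `d ℤ^S`, that is, to `(ℤ/m)^S`. -/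
theorem card_germPow (C : CycleSet S) {k m : ℕ} (h : C.dehornoyClass = k * m) :
    Nat.card (C.germPow k) = m ^ Fintype.card S := by
  have hd := C.dehornoyClass_spec.1.ne'
  have hk0 : (k : ℤ) ≠ 0 := by
    rintro h0
    rw [Nat.cast_eq_zero] at h0
    simp [h, h0] at hd
  have hm0 : (m : ℤ) ≠ 0 := by
    rintro h0
    rw [Nat.cast_eq_zero] at h0
    simp [h, h0] at hd
  have heq (a b : S → ℤ) : C.germElt C.dehornoyClass ((k : ℤ) • a) =
      C.germElt C.dehornoyClass ((k : ℤ) • b) ↔ ∀ i, (m : ℤ) ∣ a i - b i := by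
    rw [germElt_eq_iff C dvd_rfl hd]
    refine forall_congr' fun i => ?_
    simp only [Pi.smul_apply, smul_eq_mul]
    rw [← mul_sub, h, Nat.cast_mul, mul_dvd_mul_iff_left hk0]
  let f (a : S → Fin m) : C.germPow k :=
    ⟨_, (C.mem_germPow k _).2 ⟨fun i => ((a i : ℕ) : ℤ), rfl⟩⟩
  have hf : Function.Bijective f := by
    constructor
    · intro a b hab
      have := (heq _ _).1 (congrArg Subtype.val hab)
      refine funext fun i => Fin.ext ?_
      have h1 := (Nat.modEq_iff_dvd.2 (this i)).symm
      rwa [Nat.ModEq, Nat.mod_eq_of_lt (a i).2, Nat.mod_eq_of_lt (b i).2] at h1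
    · rintro ⟨x, hx⟩
      obtain ⟨a, rfl⟩ := (C.mem_germPow k x).1 hx
      have hpos (i : S) := Int.emod_nonneg (a i) hm0
      refine ⟨fun i => ⟨(a i % m).toNat, ?_⟩, Subtype.ext ((heq _ _).2 fun i => ?_)⟩
      · have := Int.emod_lt_of_pos (a i) (by positivity : (0 : ℤ) < m)
        have := hpos i
        omega
      · simp only [Int.toNat_of_nonneg (hpos i)]
        exact Int.ModEq.dvd (Int.mod_modEq _ _).symm
  rw [← Nat.card_eq_of_bijective f hf, Nat.card_fun]
  simp

/-- The diagonal part of a germ element of `B` gives its vector modulo `m`, hence its permutation.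
So the generator of `A` at `s`, once it lies in the germ of `B`, has permutation `ψ_B(s)`. -/
theorem eq_of_germAt_eq {A B : CycleSet S} {m : ℕ} (hm : B.dehornoyClass ∣ m) (h0 : m ≠ 0)
    (h : (A.germAt m : Set (GL S ℂ)) ⊆ B.germAt m) : A = B := by
  ext s t
  obtain ⟨b, hb⟩ := (B.mem_germAt m _).1 (h ((A.mem_germAt m _).2 ⟨Pi.single s 1, rfl⟩))
  have hb' := monomialGL_injective hb
  have h1 (i : S) := (zeta_zpow_eq_iff h0 _ _).1 (congrFun hb'.1 i)
  have h2 := (B.lam_congr hm h1).symm.trans hb'.2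
  rw [← Nat.cast_one, lam_single, lam_single] at h2
  simpa [bpow] using (DFunLike.congr_fun h2 t).symm

end

end CycleSet

namespace CycleSet

noncomputable section

variable {S : Type*} [Fintype S] [DecidableEq S]

/-! ### Zappa–Szép decompositions -/

theorem germPow_le_germPow (C : CycleSet S) {j k : ℕ} (h : k ∣ j) : C.germPow j ≤ C.germPow k := by
  intro x hx
  obtain ⟨a, rfl⟩ := (C.mem_germPow j x).1 hx
  obtain ⟨c, rfl⟩ := h
  refine (C.mem_germPow k _).2 ⟨(c : ℤ) • a, ?_⟩
  rw [smul_smul, Nat.cast_mul]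

/-- The factors have classes `m` and `n`, and since `gcd(kn, km) = k` their germs multiply to the
germ of `S^[k]`, which determines the cycle set. -/
theorem isZappaSzep_power_iff (C : CycleSet S) {k m n : ℕ} (hd : C.dehornoyClass = k * (m * n))
    (hmn : m.Coprime n) (C' : CycleSet S) :
    IsZappaSzep (C.power (k * n)) (C.power (k * m)) C' ↔ C' = C.power k := by
  have hA : C.dehornoyClass = k * n * m := by rw [hd]; ring
  have hB : C.dehornoyClass = k * m * n := by rw [hd]; ring
  have h0 : m * n ≠ 0 := fun h => by
    have := C.dehornoyClass_spec.1
    simp [hd, h] at this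
  have hgcd : (k * n).gcd (k * m) = k := by
    rw [Nat.gcd_mul_left, Nat.Coprime.gcd_eq_one hmn.symm, mul_one]
  have hgcd' : (k * m).gcd (k * n) = k := by rw [Nat.gcd_comm, hgcd]
  have hk : ((C.power k).germAt (m * n) : Set (GL S ℂ)) = C.germPow k := by
    rw [← C.germ_power hd, germ, C.dehornoyClass_power hd]
  constructor
  · intro h
    have hg := h.germ_eq
    rw [C.dehornoyClass_power hA, C.dehornoyClass_power hB, C.germ_power hA, C.germ_power hB,
      coe_germPow_mul_coe_germPow, hgcd, ← hk] at hg
    exact eq_of_germAt_eq (C.dehornoyClass_power hd).dvd h0 hg.subset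
  · rintro rfl
    constructor
    · rwa [C.dehornoyClass_power hA, C.dehornoyClass_power hB]
    · rw [C.germ_power hA, C.germ_power hB, coe_germPow_mul_coe_germPow,
        coe_germPow_mul_coe_germPow, hgcd, hgcd']
    · rw [C.germ_power hA, C.germ_power hB]
      exact C.germPow_inf_germPow hA hB hmn
    · rw [C.dehornoyClass_power hA, C.dehornoyClass_power hB, C.dehornoyClass_power hd]
    · rw [C.dehornoyClass_power hA, C.dehornoyClass_power hB, C.germ_power hA, C.germ_power hB,
        coe_germPow_mul_coe_germPow, hgcd, hk]

theorem eq_mul_of_mul_eq {d k b w q : ℕ} (hd0 : d ≠ 0) (hb : d = b * w) (hk : d = k * (w * q)) :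
    b = k * q := by
  have hw : 0 < w := Nat.pos_of_ne_zero fun h => hd0 (by simp [hb, h])
  refine Nat.eq_of_mul_eq_mul_right hw ?_
  rw [← hb, hk]
  ring

/-- The parameter `k` drives the induction: removing the head `p` replaces `k` by `k w_p`, and the
empty list corresponds to `k = d`, where `S^[d]` is trivial. -/
theorem isZappaSzepProduct_power_iff (C : CycleSet S) {β w : ℕ → ℕ} {l : List ℕ}
    (hl : l.Pairwise fun p q => (w p).Coprime (w q)) (hβ : ∀ p ∈ l, C.dehornoyClass = β p * w p)
    {k : ℕ} (hk : C.dehornoyClass = k * (l.map w).prod) (C' : CycleSet S) :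
    IsZappaSzepProduct (l.map fun p => C.power (β p)) C' ↔ C' = C.power k := by
  induction l generalizing k C' with
  | nil =>
    rw [List.map_nil, List.prod_nil, mul_one] at hk
    rw [← hk, power_dehornoyClass]
    constructor
    · rintro ⟨⟩
      rfl
    · rintro rfl
      exact .nil
  | cons p l ih =>
    rw [List.pairwise_cons] at hl
    rw [List.map_cons, List.prod_cons] at hk
    have hcop : (w p).Coprime (l.map w).prod := by
      refine Nat.coprime_list_prod_right_iff.2 fun n hn => ?_
      obtain ⟨q, hq, rfl⟩ := List.mem_map.1 hn
      exact hl.1 q hq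
    have hbp : β p = k * (l.map w).prod :=
      eq_mul_of_mul_eq C.dehornoyClass_spec.1.ne' (hβ p (by simp)) hk
    have ih' := ih hl.2 (fun q hq => hβ q (by simp [hq])) (k := k * w p) (by rw [hk]; ring)
    rw [List.map_cons, hbp, ← isZappaSzep_power_iff C hk hcop]
    constructor
    · rintro (_ | ⟨hL, hZ⟩)
      rwa [(ih' _).1 hL] at hZ
    · exact fun hZ => .cons ((ih' _).2 rfl) hZ

/-- The same induction inside the germ: the first factor splits off by the gcd product formula, and
uniquely so because it meets the group of the remaining factors trivially. -/
theorem existsUnique_prod_germPow (C : CycleSet S) {β w : ℕ → ℕ} {l : List ℕ} (hn : l.Nodup)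
    (hl : l.Pairwise fun p q => (w p).Coprime (w q)) (hβ : ∀ p ∈ l, C.dehornoyClass = β p * w p)
    {k : ℕ} (hk : C.dehornoyClass = k * (l.map w).prod) (g : GL S ℂ) (hg : g ∈ C.germPow k) :
    ∃! h : ℕ → GL S ℂ, (∀ p ∈ l, h p ∈ C.germPow (β p)) ∧ (∀ p ∉ l, h p = 1) ∧
      (l.map h).prod = g := by
  have hd0 := C.dehornoyClass_spec.1.ne'
  induction l generalizing k g with
  | nil =>
    rw [List.map_nil, List.prod_nil, mul_one] at hk
    obtain ⟨a, rfl⟩ := (C.mem_germPow k g).1 hg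
    have h1 : C.germElt C.dehornoyClass ((k : ℤ) • a) = 1 := by
      rw [← C.germElt_zero C.dehornoyClass, germElt_eq_iff C dvd_rfl hd0]
      intro i
      simp [← hk]
    refine ⟨1, ⟨by simp, by simp, h1.symm⟩, fun h hh => funext fun p => ?_⟩
    exact hh.2.1 p (by simp)
  | cons p l ih =>
    rw [List.pairwise_cons] at hl
    rw [List.nodup_cons] at hn
    rw [List.map_cons, List.prod_cons] at hk
    have hcop : (w p).Coprime (l.map w).prod := by
      refine Nat.coprime_list_prod_right_iff.2 fun n hn => ?_
      obtain ⟨q, hq, rfl⟩ := List.mem_map.1 hn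
      exact hl.1 q hq
    have hbp : β p = k * (l.map w).prod := eq_mul_of_mul_eq hd0 (hβ p (by simp)) hk
    have hk' : C.dehornoyClass = k * w p * (l.map w).prod := by rw [hk]; ring
    have hβ' : ∀ q ∈ l, C.dehornoyClass = β q * w q := fun q hq => hβ q (by simp [hq])
    have hle : ∀ q ∈ l, C.germPow (β q) ≤ C.germPow (k * w p) := by
      intro q hq
      obtain ⟨c, hc⟩ := List.dvd_prod (List.mem_map_of_mem (f := w) hq)
      refine C.germPow_le_germPow ⟨c, eq_mul_of_mul_eq hd0 (hβ' q hq) ?_⟩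
      rw [hk', hc]
    have hinf := C.germPow_inf_germPow (hβ p (by simp)) hk' hcop
    have hgcd : (β p).gcd (k * w p) = k := by
      rw [hbp, Nat.gcd_mul_left, Nat.Coprime.gcd_eq_one hcop.symm, mul_one]
    have hg' : g ∈ (C.germPow (β p) : Set (GL S ℂ)) * (C.germPow (k * w p) : Set (GL S ℂ)) := by
      rw [coe_germPow_mul_coe_germPow, hgcd]
      exact hg
    obtain ⟨x, hx, y, hy, rfl⟩ := hg'
    have hmap (f : ℕ → GL S ℂ) (z : GL S ℂ) : l.map (Function.update f p z) = l.map f :=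
      List.map_congr_left fun q hq => Function.update_of_ne (ne_of_mem_of_not_mem hq hn.1) _ _
    obtain ⟨h, ⟨h1, h2, h3⟩, hu⟩ := ih hn.2 hl.2 hβ' hk' y hy
    refine ⟨Function.update h p x, ⟨?_, ?_, ?_⟩, ?_⟩
    · intro q hq
      by_cases hqp : q = p
      · subst hqp
        simpa using hx
      · rw [Function.update_of_ne hqp]
        exact h1 q (by simpa [hqp] using hq)
    · intro q hq
      rw [List.mem_cons, not_or] at hq
      rw [Function.update_of_ne hq.1, h2 q hq.2]
    · rw [List.map_cons, List.prod_cons, Function.update_self, hmap, h3]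
    · rintro f ⟨hf1, hf2, hf3⟩
      rw [List.map_cons, List.prod_cons] at hf3
      have hmem : (l.map f).prod ∈ C.germPow (k * w p) := by
        refine Subgroup.list_prod_mem _ fun z hz => ?_
        obtain ⟨q, hq, rfl⟩ := List.mem_map.1 hz
        exact hle q hq (hf1 q (by simp [hq]))
      have hxf : (f p)⁻¹ * x = (l.map f).prod * y⁻¹ := by
        rw [inv_mul_eq_iff_eq_mul, ← mul_assoc, hf3, mul_inv_cancel_right]
      have hbot : (f p)⁻¹ * x ∈ C.germPow (β p) ⊓ C.germPow (k * w p) := by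
        refine Subgroup.mem_inf.2 ⟨mul_mem (inv_mem (hf1 p (by simp))) hx, ?_⟩
        rw [hxf]
        exact mul_mem hmem (inv_mem hy)
      rw [hinf, Subgroup.mem_bot] at hbot
      have hfx : f p = x := inv_mul_eq_one.1 hbot
      rw [hbot, eq_comm, mul_inv_eq_one] at hxf
      -- Uniqueness for the tail concerns functions equal to `1` off `l`, so the value at `p` is
      -- reset before it is applied.
      have := hu (Function.update f p 1) ⟨?_, ?_, ?_⟩
      · rw [← this, Function.update_idem, ← hfx, Function.update_eq_self]
      · intro q hq
        rw [Function.update_of_ne (ne_of_mem_of_not_mem hq hn.1)]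
        exact hf1 q (by simp [hq])
      · intro q hq
        by_cases hqp : q = p
        · subst hqp
          simp
        · rw [Function.update_of_ne hqp]
          exact hf2 q (by simp [hqp, hq])
      · rw [hmap, hxf]

/-- In `S^[β]`, `ψ(s^[u])` is `ψ(s^[βu])` computed in `S`; `psi_bpow_add` then telescopes the
composition. -/
theorem bezoutPerm_power (C : CycleSet S) (β u : ℕ → ℕ) (l : List ℕ) (s : S) :
    bezoutPerm (l.map fun p => (C.power (β p), u p)) s =
      C.psi (C.bpow (l.map fun p => β p * u p).sum s) := by
  induction l generalizing s with
  | nil => simp [bezoutPerm, bpow]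
  | cons p l ih =>
    rw [List.map_cons, List.map_cons, List.sum_cons, bezoutPerm, psi_bpow_power, ih, psi_bpow_add]

/-- The germ has order `d^|S|` and the subgroup has order `(p^a)^|S|`, exactly its `p`-part. -/
theorem exists_sylow_eq_germPow (C : CycleSet S) {p : ℕ} (hp : p.Prime) {k : ℕ}
    (hk : C.dehornoyClass = k * p ^ C.dehornoyClass.factorization p) :
    ∃ P : Sylow p C.germ, (P : Subgroup C.germ) = (C.germPow k).subgroupOf C.germ := by
  have : Fact p.Prime := ⟨hp⟩
  have hle : C.germPow k ≤ C.germ := by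
    rw [← germPow_one]
    exact C.germPow_le_germPow (one_dvd k)
  have hG : Nat.card C.germ = C.dehornoyClass ^ Fintype.card S := by
    rw [← germPow_one, C.card_germPow (one_mul _).symm]
  have : Finite C.germ := Nat.finite_of_card_ne_zero (by
    rw [hG]
    exact (pow_pos C.dehornoyClass_spec.1 _).ne')
  refine ⟨Sylow.ofCard _ ?_, Sylow.coe_ofCard _ _⟩
  rw [Nat.card_congr (Subgroup.subgroupOfEquivOfLe hle).toEquiv, C.card_germPow hk, hG,
    Nat.factorization_pow, ← pow_mul, Finsupp.smul_apply, smul_eq_mul, mul_comm]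

end

end CycleSet

theorem theorem4 {S : Type*} [Fintype S] [DecidableEq S] (C : CycleSet S)
    (d : ℕ) (hd : d = C.dehornoyClass)
    (β : ℕ → ℕ) (hβ : ∀ p, β p = d / p ^ d.factorization p) :
    -- the class is well defined, and the germ is the quotient of `G` by `G^[d]`
    (0 < d ∧ (∀ s, C.psi (C.bpow d s) = 1) ∧ (C.rep d).ker = C.powSubgroup d) ∧
    -- the Sylow subgroups of the germ are germs of cycle sets of prime power class
    (∀ p ∈ d.primeFactors,
      (∃ P : Sylow p C.germ, (P : Subgroup C.germ) = (C.germPow (β p)).subgroupOf C.germ) ∧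
      (C.power (β p)).dehornoyClass = p ^ d.factorization p ∧
      (C.power (β p)).germ = C.germPow (β p)) ∧
    -- they commute pairwise
    (∀ p ∈ d.primeFactors, ∀ p' ∈ d.primeFactors,
      (C.germPow (β p) : Set (GL S ℂ)) * (C.germPow (β p') : Set (GL S ℂ)) =
        C.germPow (β p') * C.germPow (β p)) ∧
    -- for every enumeration `l` of the prime divisors of `d`
    (∀ l : List ℕ, l.Nodup → l.toFinset = d.primeFactors →
      -- the germ is the product of its Sylow subgroups, with unique factorization
      (∀ g ∈ C.germ, ∃! h : ℕ → GL S ℂ, (∀ p ∈ l, h p ∈ C.germPow (β p)) ∧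
        (∀ p ∉ l, h p = 1) ∧ (l.map h).prod = g) ∧
      -- `C` is the Zappa–Szép product of the corresponding cycle sets, and is determined by them
      (∀ C' : CycleSet S,
        CycleSet.IsZappaSzepProduct (l.map fun p => C.power (β p)) C' ↔ C' = C) ∧
      -- explicit reconstruction of `C` from these cycle sets
      (∀ u : ℕ → ℕ, (∑ p ∈ d.primeFactors, β p * u p) ≡ 1 [MOD d] → ∀ s t : S,
        C.op s t = CycleSet.bezoutPerm (l.map fun p => (C.power (β p), u p)) s t)) := by
  subst hd
  obtain ⟨hpos, hpsi⟩ := C.dehornoyClass_spec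
  have hfac (p : ℕ) : C.dehornoyClass = β p * p ^ C.dehornoyClass.factorization p := by
    rw [hβ, Nat.div_mul_cancel (Nat.ordProj_dvd _ _)]
  refine ⟨⟨hpos, hpsi, C.ker_rep_dehornoyClass⟩, fun p hp => ⟨?_, ?_, ?_⟩, fun p _ q _ => ?_,
    fun l hn hl => ?_⟩
  · exact C.exists_sylow_eq_germPow (Nat.prime_of_mem_primeFactors hp) (hfac p)
  · exact C.dehornoyClass_power (hfac p)
  · exact C.germ_power (hfac p)
  · rw [C.coe_germPow_mul_coe_germPow, C.coe_germPow_mul_coe_germPow, Nat.gcd_comm]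
  have hprime : ∀ p ∈ l, p.Prime := fun p hp =>
    Nat.prime_of_mem_primeFactors (hl ▸ List.mem_toFinset.2 hp)
  have hcop : l.Pairwise fun p q => (p ^ C.dehornoyClass.factorization p).Coprime
      (q ^ C.dehornoyClass.factorization q) :=
    hn.imp_of_mem fun hp hq hpq =>
      Nat.Coprime.pow _ _ ((Nat.coprime_primes (hprime _ hp) (hprime _ hq)).2 hpq)
  have hprod : C.dehornoyClass =
      1 * (l.map fun p => p ^ C.dehornoyClass.factorization p).prod := by
    rw [one_mul, ← List.prod_toFinset _ hn, hl]
    exact (Nat.prod_factorization_pow_eq_self hpos.ne').symm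
  refine ⟨fun g hg => ?_, fun C' => ?_, fun u hu s t => ?_⟩
  · exact C.existsUnique_prod_germPow hn hcop (fun p _ => hfac p) hprod g (C.germPow_one ▸ hg)
  · rw [C.isZappaSzepProduct_power_iff hcop (fun p _ => hfac p) hprod, C.power_one]
  -- `ψ(s^[n])` depends only on `n` modulo `d`, so the Bézout sum may be replaced by `1`.
  · rw [C.bezoutPerm_power, ← List.sum_toFinset _ hn, hl, ← C.psi_bpow_mod, hu, C.psi_bpow_mod]
    simp [CycleSet.bpow]
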